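/- A digraph $D=(V,A)$ consists of a finite set $V$ of vertices and a finite set $A$ of arcs, each arc having an origin and a target in $V$; loops and multiple arcs are allowed. $D$ is *acyclic* if it has no directed cycle (a loop is a directed cycle), and *totally cyclic* if each of its arcs lies in a directed cycle. Let $v(D)$ be the number of vertices of $D$, and $c(D)$ the number of connected components of its underlying graph. For disjoint $R,T\subseteq A$, let $D^{-T}_{\setminus R}$ (respectively $D^{-T}_{/R}$) be the digraph obtained from $D$ by reversing the arcs in $T$ and deleting the arcs in $R$ (respectively, contracting the arcs in $R$, that is, removing them and identifying their endpoints); $T$ or $R$ is omitted from the notation when empty. The $B$-polynomial of $D$ is the unique polynomial $B_D(q,y,z)$ with rational coefficients such that, for every positive integer $q$, $$B_D(q,y,z)=\sum_{f:V\to\{1,\dots,q\}}y^{\#\{(u,v)\in A\,:\,f(v)>f(u)\}}\,z^{\#\{(u,v)\in A\,:\,f(v)<f(u)\}}.$$ **Theorem.** For every digraph $D=(V,A)$, where $R\uplus S\uplus T=A$ means that $(R,S,T)$ ranges over the ordered partitions of $A$ into three possibly empty sets, $$\sum_{\substack{R\uplus S\uplus T=A\\ D^{-T}_{\setminus R}\text{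 acyclic}}}y^{|S|}z^{|T|}=(-1)^{|V|}B_D(-1,1+y,1+z),$$ $$\sum_{\substack{R\uplus S\uplus T=A\\ D^{-T}_{\setminus R}\text{ totally cyclic}}}y^{|S|}z^{|T|}(-1)^{c(D^{-T}_{\setminus R})}=(1+y+z)^{|A|}B_D\Bigl(-1,\tfrac{1+y}{1+y+z},\tfrac{1+z}{1+y+z}\Bigr),$$ $$\sum_{\substack{R\uplus S\uplus T=A\\ D^{-T}_{/R}\text{ acyclic}}}y^{|S|}z^{|T|}(-1)^{v(D^{-T}_{/R})}=B_D(-1,y,z),$$ $$\sum_{\substack{R\uplus S\uplus T=A\\ D^{-T}_{/R}\text{ totally cyclic}}}y^{|S|}z^{|T|}=(-1)^{c(D)}(1+y+z)^{|A|}B_D\Bigl(-1,\tfrac{y}{1+y+z},\tfrac{z}{1+y+z}\Bigr).$$ Moreover, writing $[z^k]P$ for the coefficient of $z^k$ in $P$, $$\sum_{\substack{S\subseteq A\\ D^{-S}\text{ acyclic}}}y^{|S|}=(-1)^{|V|}[z^{|A|}]B_D(-1,yz,z),\qquad \sum_{\substack{S\subseteq A\\ D_{\setminus S}\text{ acyclic}}}y^{|A\setminus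 S|}=(-1)^{|V|}B_D(-1,1+y,1),$$ $$\sum_{\substack{S\subseteq A\\ D^{-S}\text{ totally cyclic}}}y^{|S|}=(-1)^{c(D)}(1+y)^{|A|}B_D\Bigl(-1,\tfrac{y}{1+y},\tfrac{1}{1+y}\Bigr),\qquad \sum_{\substack{S\subseteq A\\ D_{/S}\text{ totally cyclic}}}y^{|A\setminus S|}=(-1)^{c(D)}(1+y)^{|A|}B_D\Bigl(-1,\tfrac{y}{1+y},0\Bigr).$$ These identities hold for all $y,z$ in any field of characteristic $0$ (in particular for indeterminates $y,z$), provided that the denominators that occur are nonzero. -/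

import Mathlib

/-- A directed graph with vertex set `V` and arc set `A`; loops and multiple arcs are allowed
(several labels in `A` may carry the same ordered pair of vertices). -/
structure MultiDigraph (V A : Type*) where
  /-- the origin of an arc -/
  src : A → V
  /-- the target of an arc -/
  tgt : A → V

namespace MultiDigraph

variable {V A : Type*}

/-- `u` and `v` are the origin and the target of some arc belonging to `R`. -/
def JoinedBy (D : MultiDigraph V A) (R : Set A) (u v : V) : Prop :=
  ∃ a ∈ R, D.src a = u ∧ D.tgt a = v

/-- Deletion of the arcs in `R`. -/
def delete (D : MultiDigraph V A) (R : Finset A) : MultiDigraph V {a : A // a ∉ R} where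
  src a := D.src a
  tgt a := D.tgt a

/-- Contraction of the arcs in `R`: they are removed, and their endpoints are identified.
(`Quot r` is the quotient by the equivalence relation generated by `r`.) -/
def contract (D : MultiDigraph V A) (R : Finset A) :
    MultiDigraph (Quot (D.JoinedBy (R : Set A))) {a : A // a ∉ R} where
  src a := Quot.mk _ (D.src a)
  tgt a := Quot.mk _ (D.tgt a)

/-- Reorientation of the arcs in `T`: each `(u, v)` with label in `T` becomes `(v, u)`. -/
def reorient [DecidableEq A] (D : MultiDigraph V A) (T : Finset A) : MultiDigraph V A where
  src a := if a ∈ T then D.tgt a else D.src a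
  tgt a := if a ∈ T then D.src a else D.tgt a

/-- The number of vertices. -/
noncomputable def vertexCount (_D : MultiDigraph V A) : ℕ := Nat.card V

/-- The number of connected components of the underlying graph. -/
noncomputable def componentCount (D : MultiDigraph V A) : ℕ :=
  Nat.card (Quot (D.JoinedBy Set.univ))

/-- A directed cycle: a nonempty cyclic sequence of arcs in which the target of each arc is the
origin of the next one, and which visits each vertex at most once. A loop is a directed cycle of
length one. -/
def IsDirectedCycle (D : MultiDigraph V A) (c : Cycle A) : Prop :=
  c ≠ Cycle.nil ∧ c.Chain (fun a b => D.tgt a = D.src b) ∧ (c.map D.src).Nodup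

/-- An arc is cyclic if it is in a directed cycle. -/
def IsCyclicArc (D : MultiDigraph V A) (a : A) : Prop :=
  ∃ c : Cycle A, D.IsDirectedCycle c ∧ a ∈ c

/-- No directed cycle. -/
def IsAcyclic (D : MultiDigraph V A) : Prop := ∀ c : Cycle A, ¬ D.IsDirectedCycle c

/-- Every arc is in a directed cycle. -/
def IsTotallyCyclic (D : MultiDigraph V A) : Prop := ∀ a : A, D.IsCyclicArc a

noncomputable instance (D : MultiDigraph V A) : Decidable D.IsAcyclic := Classical.dec _

noncomputable instance (D : MultiDigraph V A) : Decidable D.IsTotallyCyclic := Classical.dec _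

/-- The ordered triples `(R, S, T)` with `R ⊎ S ⊎ T = A`. -/
def triPartitions (A : Type*) [Fintype A] [DecidableEq A] :
    Finset (Finset A × Finset A × Finset A) :=
  {p | Disjoint p.1 p.2.1 ∧ Disjoint p.1 p.2.2 ∧ Disjoint p.2.1 p.2.2 ∧
    p.1 ∪ p.2.1 ∪ p.2.2 = Finset.univ}

section Coloring

variable [Fintype A]

/-- The ascents of a coloring: the arcs `(u, v)` with `f v > f u`. -/
def ascents {q : ℕ} (D : MultiDigraph V A) (f : V → Fin q) : Finset A :=
  {a | f (D.tgt a) > f (D.src a)}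

/-- The descents of a coloring: the arcs `(u, v)` with `f v < f u`. -/
def descents {q : ℕ} (D : MultiDigraph V A) (f : V → Fin q) : Finset A :=
  {a | f (D.tgt a) < f (D.src a)}

variable [Fintype V] [DecidableEq V]

/-- The defining property of the `B`-polynomial, in the variables `0 = q`, `1 = y`, `2 = z`:
for all positive integers `q`, it counts the `q`-colorings by ascents and descents. -/
def IsBPolynomial (D : MultiDigraph V A) (B : MvPolynomial (Fin 3) ℚ) : Prop :=
  ∀ q : ℕ, 0 < q → ∀ y z : ℚ,
    MvPolynomial.eval ![(q : ℚ), y, z] B =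
      ∑ f : V → Fin q, y ^ (D.ascents f).card * z ^ (D.descents f).card

/-- The `B`-polynomial, written out as
`∑ p, q (q - 1) ⋯ (q - p + 1) / p! * ∑ g : V ↠ [p], y ^ asc g * z ^ desc g`;
`isBPolynomial_iff` below shows that it is the only polynomial with the defining property. -/
noncomputable def bPoly (D : MultiDigraph V A) : MvPolynomial (Fin 3) ℚ :=
  ∑ p ∈ Finset.range (Fintype.card V + 1),
    MvPolynomial.C (1 / (p.factorial : ℚ)) *
      (∏ i ∈ Finset.range p, (MvPolynomial.X 0 - MvPolynomial.C (i : ℚ))) *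
      ∑ g : V → Fin p with Function.Surjective g,
        MvPolynomial.X 1 ^ (D.ascents g).card * MvPolynomial.X 2 ^ (D.descents g).card

theorem sum_colorings_of_image_eq (D : MultiDigraph V A) {q p : ℕ} (s : Finset (Fin q))
    (hs : s.card = p) (y z : ℚ) :
    ∑ f : V → Fin q with Finset.univ.image f = s,
        y ^ (D.ascents f).card * z ^ (D.descents f).card =
      ∑ g : V → Fin p with Function.Surjective g,
        y ^ (D.ascents g).card * z ^ (D.descents g).card := by
  symm
  refine Finset.sum_bij (fun g _ => fun v => s.orderEmbOfFin hs (g v)) ?_ ?_ ?_ ?_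
  · intro g hg
    simp only [Finset.mem_filter, Finset.mem_univ, true_and] at hg ⊢
    ext x
    have hx : x ∈ Set.range (s.orderEmbOfFin hs) ↔ x ∈ s := by simp
    rw [← hx]
    simp only [Finset.mem_image, Finset.mem_univ, true_and, Set.mem_range]
    constructor
    · rintro ⟨v, rfl⟩
      exact ⟨_, rfl⟩
    · rintro ⟨i, rfl⟩
      obtain ⟨v, rfl⟩ := hg i
      exact ⟨v, rfl⟩
  · intro g _ g' _ h
    funext v
    exact (s.orderEmbOfFin hs).injective (congrFun h v)
  · intro f hf
    simp only [Finset.mem_filter, Finset.mem_univ, true_and] at hf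
    have hm : ∀ v, ∃ i, s.orderEmbOfFin hs i = f v := by
      intro v
      have : f v ∈ Set.range (s.orderEmbOfFin hs) := by
        rw [Finset.range_orderEmbOfFin, ← hf]
        simp
      exact this
    choose g hg using hm
    refine ⟨g, ?_, funext hg⟩
    simp only [Finset.mem_filter, Finset.mem_univ, true_and]
    intro i
    have hi : s.orderEmbOfFin hs i ∈ Finset.univ.image f := by
      rw [hf]
      exact Finset.orderEmbOfFin_mem s hs i
    obtain ⟨v, -, hv⟩ := Finset.mem_image.1 hi
    exact ⟨v, (s.orderEmbOfFin hs).injective (by rw [hg, hv])⟩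
  · intro g _
    simp [ascents, descents]

theorem isBPolynomial_bPoly (D : MultiDigraph V A) : D.IsBPolynomial D.bPoly := by
  intro q _ y z
  have hmap : ∀ f ∈ (Finset.univ : Finset (V → Fin q)),
      (Finset.univ.image f).card ∈ Finset.range (Fintype.card V + 1) := by
    intro f _
    rw [Finset.mem_range, Nat.lt_succ_iff]
    exact Finset.card_image_le
  rw [← Finset.sum_fiberwise_of_maps_to hmap, bPoly, map_sum]
  refine Finset.sum_congr rfl fun p _ => ?_
  have hmap2 : ∀ f ∈ (Finset.univ : Finset (V → Fin q)).filter
      (fun f => (Finset.univ.image f).card = p),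
      Finset.univ.image f ∈ Finset.powersetCard p (Finset.univ : Finset (Fin q)) := by
    intro f hf
    simpa [Finset.mem_powersetCard] using hf
  rw [← Finset.sum_fiberwise_of_maps_to hmap2]
  have hin : ∀ s ∈ Finset.powersetCard p (Finset.univ : Finset (Fin q)),
      ∑ f ∈ ((Finset.univ : Finset (V → Fin q)).filter
          (fun f => (Finset.univ.image f).card = p)).filter (fun f => Finset.univ.image f = s),
        y ^ (D.ascents f).card * z ^ (D.descents f).card =
      ∑ g : V → Fin p with Function.Surjective g,
        y ^ (D.ascents g).card * z ^ (D.descents g).card := by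
    intro s hs
    have hc := (Finset.mem_powersetCard.1 hs).2
    rw [← D.sum_colorings_of_image_eq s hc, Finset.filter_filter]
    refine Finset.sum_congr (Finset.filter_congr fun f _ => ?_) fun _ _ => rfl
    constructor
    · exact fun h => h.2
    · intro h
      exact ⟨by rw [h, hc], h⟩
  rw [Finset.sum_congr rfl hin, Finset.sum_const, Finset.card_powersetCard, Finset.card_univ,
    Fintype.card_fin, nsmul_eq_mul]
  have hch : (q.choose p : ℚ) =
      1 / (p.factorial : ℚ) * ∏ i ∈ Finset.range p, ((q : ℚ) - (i : ℚ)) := by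
    rw [← descPochhammer_eval_eq_prod_range, descPochhammer_eval_eq_descFactorial,
      Nat.descFactorial_eq_factorial_mul_choose]
    have : (p.factorial : ℚ) ≠ 0 := by exact_mod_cast p.factorial_ne_zero
    push_cast
    field_simp
  rw [hch]
  simp [map_prod]

theorem isBPolynomial_iff (D : MultiDigraph V A) (B : MvPolynomial (Fin 3) ℚ) :
    D.IsBPolynomial B ↔ B = D.bPoly := by
  constructor
  · intro h
    refine MvPolynomial.funext_set
      ![Set.range (fun n : ℕ => ((n + 1 : ℕ) : ℚ)), Set.univ, Set.univ] ?_ ?_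
    · intro i
      fin_cases i
      · exact Set.infinite_range_of_injective fun a b hab => by simpa using hab
      · exact Set.infinite_univ
      · exact Set.infinite_univ
    · intro x hx
      obtain ⟨n, hn⟩ := hx 0 (Set.mem_univ _)
      have hxe : x = ![((n + 1 : ℕ) : ℚ), x 1, x 2] := by
        funext i
        fin_cases i
        · exact hn.symm
        · rfl
        · rfl
      rw [hxe, h (n + 1) n.succ_pos, D.isBPolynomial_bPoly (n + 1) n.succ_pos]
  · rintro rfl
    exact D.isBPolynomial_bPoly

/-- The value `B_D(q, y, z)` of the `B`-polynomial at elements of a commutative `ℚ`-algebra. -/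
noncomputable def bEval {K : Type*} [CommRing K] [Algebra ℚ K] (D : MultiDigraph V A)
    (q y z : K) : K :=
  MvPolynomial.aeval ![q, y, z] D.bPoly

end Coloring

end MultiDigraph

/-! Since the binomial coefficient `(-1 choose p)` is `(-1) ^ p`, the value at `q = -1` is an
alternating sum over surjective colorings `V ↠ [p]`. Homogenizing gives `altSum x y z`, with weight
`x` on ties, `y` on ascents and `z` on descents; multiplying by the `|A|`-th power of a denominator
just clears it (`pow_card_mul_bEval`). On each arc the weight is a combination of indicators of
`True`, `=`, `<`, `≤` and their reverses. For instance, `True + y[<] + z[>]` gives `1`, `1 + y`, `1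
+ z` on ties, ascents and descents. Expanding the product over arcs yields a sum over choices of one
condition per arc: `True` deletes the arc, `=` contracts it, a reversed inequality reorients it
(`altSum_eq_sum`). Each identity thus reduces to an alternating count of surjections monotone along
the arcs of a minor. These counts are two reciprocity laws: strictly increasing surjections give
`(-1) ^ |V|` if the digraph is acyclic and `0` otherwise (`sum_strict_surjections`); weakly
increasing ones give `(-1) ^ c` if it is totally cyclic and `0` otherwise (`sum_weak_surjections`).
Removing the top color class gives a recursion over vertex subsets with a unique solution
(`sum_neg_one_pow_card_levelings`). An explicit solution is verified by a sign-reversing involution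
that toggles a sink in the strict case and a source strong component in the weak case. -/

namespace MultiDigraph

/-! ### Directed cycles in terms of reachability. -/

section Walks

variable {V A : Type*}

/-- The list of arcs `l` is a directed walk from `u` to `v`. -/
def IsArcWalk (D : MultiDigraph V A) : V → List A → V → Prop
  | u, [], v => u = v
  | u, a :: l, v => D.src a = u ∧ D.IsArcWalk (D.tgt a) l v

theorem joinedBy_univ (D : MultiDigraph V A) (a : A) :
    D.JoinedBy Set.univ (D.src a) (D.tgt a) :=
  ⟨a, Set.mem_univ a, rfl, rfl⟩

theorem IsArcWalk.exists_suffix {D : MultiDigraph V A} {u v x : V} {l : List A}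
    (h : D.IsArcWalk u l v) (hl : (l.map D.src).Nodup) (hv : v ∉ l.map D.src)
    (hx : x ∈ l.map D.src) :
    ∃ l', D.IsArcWalk x l' v ∧ (l'.map D.src).Nodup ∧ v ∉ l'.map D.src := by
  induction l generalizing u with
  | nil => simp at hx
  | cons a l ih =>
    by_cases hax : D.src a = x
    · exact ⟨a :: l, ⟨hax, h.2⟩, hl, hv⟩
    · simp only [List.map_cons, List.mem_cons, List.nodup_cons, not_or] at hl hv hx
      exact ih h.2 hl.2 hv.2 (hx.resolve_left fun e => hax e.symm)

theorem exists_isArcWalk_nodup (D : MultiDigraph V A) {u v : V}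
    (h : Relation.ReflTransGen (D.JoinedBy Set.univ) u v) :
    ∃ l, D.IsArcWalk u l v ∧ (l.map D.src).Nodup ∧ v ∉ l.map D.src := by
  induction h using Relation.ReflTransGen.head_induction_on with
  | refl => exact ⟨[], rfl, by simp, by simp⟩
  | head hab _ ih =>
    obtain ⟨a, -, rfl, rfl⟩ := hab
    obtain ⟨l, hw, hl, hv⟩ := ih
    -- Prepending `a` may revisit a vertex: then the walk is cut to a suffix, or to the empty walk
    -- if that vertex is the endpoint.
    by_cases hx : D.src a ∈ l.map D.src
    · exact hw.exists_suffix hl hv hx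
    · by_cases hav : v = D.src a
      · exact ⟨[], hav.symm, by simp, by simp⟩
      · exact ⟨a :: l, ⟨rfl, hw⟩, by simpa using ⟨by simpa using hx, hl⟩,
          by simpa [hav] using hv⟩

theorem isArcWalk_tgt_iff (D : MultiDigraph V A) (a b : A) (l : List A) :
    D.IsArcWalk (D.tgt a) l (D.src b) ↔
      (a :: (l ++ [b])).IsChain (fun a b => D.tgt a = D.src b) := by
  induction l generalizing a with
  | nil => simp [IsArcWalk]
  | cons c l ih => simp [IsArcWalk, ih c, eq_comm]

theorem IsArcWalk.reflTransGen {D : MultiDigraph V A} {u v : V} {l : List A}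
    (h : D.IsArcWalk u l v) : Relation.ReflTransGen (D.JoinedBy Set.univ) u v := by
  induction l generalizing u with
  | nil => exact h ▸ .refl
  | cons a l ih => exact .head (h.1 ▸ D.joinedBy_univ a) (ih h.2)

/-- A walk from the target back to the source can be shortened until it repeats no vertex, and `a`
then closes it to a directed cycle. From here on cycles enter only through reachability. -/
theorem isCyclicArc_iff (D : MultiDigraph V A) (a : A) :
    D.IsCyclicArc a ↔ Relation.ReflTransGen (D.JoinedBy Set.univ) (D.tgt a) (D.src a) := by
  constructor
  · rintro ⟨c, ⟨-, hc, -⟩, ha⟩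
    induction c using Cycle.induction_on with
    | nil => simp at ha
    | cons b l _ =>
      have ha' : a ∈ b :: l := ha
      obtain ⟨l₁, l₂, hl⟩ := List.append_of_mem ha'
      have hrot : ((b :: l : List A) : Cycle A) = ((a :: (l₂ ++ l₁) : List A) : Cycle A) := by
        rw [hl, Cycle.coe_eq_coe]
        exact List.isRotated_append
      rw [hrot, Cycle.chain_coe_cons] at hc
      exact ((D.isArcWalk_tgt_iff a a _).2 hc).reflTransGen
  · intro h
    obtain ⟨l, hw, hl, hv⟩ := D.exists_isArcWalk_nodup h
    refine ⟨((a :: l : List A) : Cycle A), ⟨?_, ?_, ?_⟩, ?_⟩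
    · simp
    · rw [Cycle.chain_coe_cons]
      exact (D.isArcWalk_tgt_iff a a _).1 hw
    · rw [Cycle.map_coe, Cycle.nodup_coe_iff]
      simpa using ⟨by simpa using hv, hl⟩
    · simp

theorem isAcyclic_iff (D : MultiDigraph V A) : D.IsAcyclic ↔ ∀ a, ¬ D.IsCyclicArc a := by
  constructor
  · rintro h a ⟨c, hc, -⟩
    exact h c hc
  · intro h c hc
    induction c using Cycle.induction_on with
    | nil => exact hc.1 rfl
    | cons b l _ => exact h b ⟨_, hc, by simp⟩

theorem IsAcyclic.exists_sink [Finite V] {D : MultiDigraph V A} (hD : D.IsAcyclic)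
    {W : Finset V} (hW : W.Nonempty) : ∃ m ∈ W, ∀ a, D.src a = m → D.tgt a ∉ W := by
  -- Reachability is reversed so that an `r`-minimal element of `W` is a sink of `W`.
  let r : V → V → Prop := fun u v => Relation.TransGen (D.JoinedBy Set.univ) v u
  have hirr : ∀ v, ¬ r v v := by
    intro v hv
    obtain ⟨w, ⟨a, -, rfl, rfl⟩, hw⟩ := Relation.TransGen.head'_iff.1 hv
    exact (D.isAcyclic_iff.1 hD) a ((D.isCyclicArc_iff a).2 hw)
  have : Std.Irrefl r := ⟨hirr⟩
  have : IsTrans V r := ⟨fun _ _ _ h₁ h₂ => h₂.trans h₁⟩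
  obtain ⟨m, hm, hmin⟩ := (Finite.wellFounded_of_trans_of_irrefl r).has_min (W : Set V) hW
  refine ⟨m, hm, fun a ha ht => hmin _ ht ?_⟩
  subst ha
  exact .single (D.joinedBy_univ a)

end Walks

/-! ### Alternating counts by peeling off top levels. -/

section Levelings

variable {V : Type*} [Fintype V] [DecidableEq V]

open Classical in
/-- The functions that vanish exactly outside `W`, take on `W` exactly the values `1, …, p`, and
on `W` are weakly increasing along `w` and strictly increasing along `s`. -/
noncomputable def levelings (w s : V → V → Prop) (p : ℕ) (W : Finset V) : Finset (V → ℕ) :=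
  {f ∈ Fintype.piFinset fun _ => Finset.range (p + 1) |
    (∀ v, f v = 0 ↔ v ∉ W) ∧ (∀ i, 1 ≤ i → i ≤ p → ∃ v, f v = i) ∧
    ∀ u ∈ W, ∀ v ∈ W, (w u v → f u ≤ f v) ∧ (s u v → f u < f v)}

/-- The set `W \ U` can be the top level of a leveling of `W`. -/
def IsTopStep (w s : V → V → Prop) (U W : Finset V) : Prop :=
  ∀ u ∈ W, ∀ v ∈ W, (w u v → v ∈ U → u ∈ U) ∧ (s u v → u ∈ U)

theorem mem_levelings {w s : V → V → Prop} {p : ℕ} {W : Finset V} {f : V → ℕ} :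
    f ∈ levelings w s p W ↔ (∀ v, f v ≤ p) ∧
      (∀ v, f v = 0 ↔ v ∉ W) ∧ (∀ i, 1 ≤ i → i ≤ p → ∃ v, f v = i) ∧
      ∀ u ∈ W, ∀ v ∈ W, (w u v → f u ≤ f v) ∧ (s u v → f u < f v) := by
  simp [levelings, Fintype.mem_piFinset]

theorem card_levelings_zero (w s : V → V → Prop) (W : Finset V) :
    (levelings w s 0 W).card = if W = ∅ then 1 else 0 := by
  split_ifs with hW
  · subst hW
    rw [Finset.card_eq_one]
    refine ⟨fun _ => 0, ?_⟩
    ext f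
    simp only [mem_levelings, Finset.mem_singleton]
    constructor
    · exact fun h => funext fun v => by simpa using h.1 v
    · rintro rfl
      simp
      intro i h1 h2
      omega
  · rw [Finset.card_eq_zero, Finset.eq_empty_iff_forall_notMem]
    intro f hf
    obtain ⟨h1, h2, -, -⟩ := mem_levelings.1 hf
    obtain ⟨v, hv⟩ := Finset.nonempty_of_ne_empty hW
    exact (h2 v).1 (by simpa using h1 v) hv

-- Removing the vertices of level `p + 1` leaves a leveling of a proper subset `U`; the top-step
-- condition says exactly that putting `W \ U` back on top respects all constraints.
open Classical in
theorem card_levelings_succ (w s : V → V → Prop) (p : ℕ) (W : Finset V) :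
    (levelings w s (p + 1) W).card =
      ∑ U ∈ W.ssubsets with IsTopStep w s U W, (levelings w s p U).card := by
  rw [← Finset.card_sigma]
  refine Finset.card_bij'
    -- The removed vertices get the value `0`, which marks the outside of the smaller set.
    (fun f _ => (⟨{v ∈ W | f v ≤ p}, fun v => if f v ≤ p then f v else 0⟩ :
      (_ : Finset V) × (V → ℕ)))
    (fun x _ => fun v => if v ∈ x.1 then x.2 v else if v ∈ W then p + 1 else 0) ?_ ?_ ?_ ?_
  · intro f hf
    obtain ⟨h1, h2, h3, h4⟩ := mem_levelings.1 hf
    simp only [Finset.mem_sigma, Finset.mem_filter, Finset.mem_ssubsets, mem_levelings]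
    refine ⟨⟨?_, ?_⟩, ?_, ?_, ?_, ?_⟩
    · refine Finset.filter_ssubset.2 ?_
      obtain ⟨v, hv⟩ := h3 (p + 1) (by omega) le_rfl
      refine ⟨v, ?_, by omega⟩
      by_contra hvW
      have := (h2 v).2 hvW
      omega
    · intro u hu v hv
      have := h4 u hu v hv
      simp only [Finset.mem_filter, hu, hv, true_and]
      refine ⟨fun h h' => (this.1 h).trans h', fun h => ?_⟩
      have := this.2 h
      have := h1 v
      omega
    · intro v
      split_ifs <;> omega
    · intro v
      have := h2 v
      split_ifs with h
      · rw [this]; simp [h]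
      · simp [h]
    · intro i hi hip
      obtain ⟨v, hv⟩ := h3 i hi (by omega)
      exact ⟨v, by rw [if_pos (by omega), hv]⟩
    · intro u hu v hv
      rw [if_pos hu.2, if_pos hv.2]
      exact h4 u hu.1 v hv.1
  · rintro ⟨U, f⟩ hx
    simp only [Finset.mem_sigma, Finset.mem_filter, Finset.mem_ssubsets, mem_levelings] at hx
    obtain ⟨⟨hUW, hstep⟩, h1, h2, h3, h4⟩ := hx
    simp only [mem_levelings]
    refine ⟨?_, ?_, ?_, ?_⟩
    · intro v
      have := h1 v
      split_ifs <;> omega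
    · intro v
      have := h2 v
      by_cases hv : v ∈ U
      · simp only [hv, if_true, hUW.1 hv, not_true, iff_false]
        intro h0
        exact this.1 h0 hv
      · by_cases hvW : v ∈ W <;> simp [hv, hvW]
    · intro i hi hip
      rcases Nat.lt_or_ge p i with h | h
      · obtain ⟨v, hvW, hvU⟩ := Finset.exists_of_ssubset hUW
        exact ⟨v, by rw [if_neg hvU, if_pos hvW]; omega⟩
      · obtain ⟨v, hv⟩ := h3 i hi h
        refine ⟨v, ?_⟩
        rw [if_pos, hv]
        by_contra hvU
        have := (h2 v).2 hvU
        omega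
    · intro u hu v hv
      have hs := hstep u hu v hv
      have := h1 u
      have := h1 v
      by_cases huU : u ∈ U <;> by_cases hvU : v ∈ U <;> simp only [huU, hvU, hu, hv, if_true, if_false]
      · exact h4 u huU v hvU
      · exact ⟨fun _ => by omega, fun _ => by omega⟩
      · exact ⟨fun h => absurd (hs.1 h hvU) huU, fun h => absurd (hs.2 h) huU⟩
      · exact ⟨fun _ => le_rfl, fun h => absurd (hs.2 h) huU⟩
  · intro f hf
    obtain ⟨h1, h2, h3, h4⟩ := mem_levelings.1 hf
    funext v
    have h1v := h1 v
    have h2v := h2 v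
    by_cases hv : v ∈ W
    · by_cases hp : f v ≤ p
      · simp [hv, hp]
      · simp [hv, hp]; omega
    · simp [hv, h2v.2 hv]
  · rintro ⟨U, f⟩ hx
    simp only [Finset.mem_sigma, Finset.mem_filter, Finset.mem_ssubsets, mem_levelings] at hx
    obtain ⟨⟨hUW, hstep⟩, h1, h2, h3, h4⟩ := hx
    have hU : ({v ∈ W | (if v ∈ U then f v else if v ∈ W then p + 1 else 0) ≤ p} : Finset V) =
        U := by
      ext v
      by_cases hv : v ∈ U
      · simp [hv, hUW.1 hv, h1 v]
      · by_cases hvW : v ∈ W <;> simp [hv, hvW]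
    have hf : (fun v => if (if v ∈ U then f v else if v ∈ W then p + 1 else 0) ≤ p then
        (if v ∈ U then f v else if v ∈ W then p + 1 else 0) else 0) = f := by
      funext v
      by_cases hv : v ∈ U
      · simp [hv, h1 v]
      · have := (h2 v).2 hv
        by_cases hvW : v ∈ W <;> simp [hv, hvW, this]
    simp only [Sigma.mk.injEq]
    exact ⟨hU, heq_of_eq hf⟩

open Classical in
/-- The alternating count of levelings is determined by its recursion over top levels. -/
theorem sum_neg_one_pow_card_levelings (w s : V → V → Prop) (g : Finset V → ℤ)
    (H : Finset V → Prop) (hH : ∀ W, H W → ∀ U ⊆ W, IsTopStep w s U W → H U)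
    (hrec : ∀ W, H W → ∑ U ∈ W.powerset with IsTopStep w s U W, g U = if W = ∅ then 1 else 0)
    (W : Finset V) (hW : H W) (n : ℕ) (hn : W.card < n) :
    ∑ p ∈ Finset.range n, (-1 : ℤ) ^ p * (levelings w s p W).card = g W := by
  induction W using Finset.strongInduction generalizing n with
  | H W ih =>
    obtain ⟨n, rfl⟩ : ∃ m, n = m + 1 := ⟨n - 1, by omega⟩
    have hself : IsTopStep w s W W := fun u hu v _ => ⟨fun _ _ => hu, fun _ => hu⟩
    have hW' := hrec W hW
    -- The term `U = W` is the unknown `g W`; isolating it expresses `g W` through proper subsets.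
    rw [← Finset.insert_erase (Finset.mem_powerset_self W), ← Finset.ssubsets,
      Finset.filter_insert, if_pos hself, Finset.sum_insert (by simp)]
      at hW'
    rw [Finset.sum_range_succ', card_levelings_zero]
    -- Peeling a level costs one sign and lowers the range bound by one, which still exceeds the
    -- size of the smaller set.
    have h2 : ∑ p ∈ Finset.range n, (-1 : ℤ) ^ (p + 1) * (levelings w s (p + 1) W).card =
        - ∑ U ∈ W.ssubsets with IsTopStep w s U W, g U := by
      simp_rw [card_levelings_succ, Nat.cast_sum, Finset.mul_sum]
      rw [Finset.sum_comm, ← Finset.sum_neg_distrib]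
      refine Finset.sum_congr rfl fun U hU => ?_
      obtain ⟨hU, hstep⟩ := Finset.mem_filter.1 hU
      have hUW := Finset.mem_ssubsets.1 hU
      rw [← ih U hUW (hH W hW U hUW.1 hstep) n
        (lt_of_lt_of_le (Finset.card_lt_card hUW) (by omega)), ← Finset.sum_neg_distrib]
      exact Finset.sum_congr rfl fun p _ => by ring
    rw [h2]
    push_cast
    linarith

theorem card_levelings_univ (w s : V → V → Prop) (p : ℕ) :
    (levelings w s p Finset.univ).card =
      Set.ncard {g : V → Fin p | Function.Surjective g ∧
        ∀ u v, (w u v → g u ≤ g v) ∧ (s u v → g u < g v)} := by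
  classical
  rw [Set.ncard_eq_toFinset_card', Set.toFinset_ofPred]
  symm
  -- Colors shift by one because level `0` is reserved for vertices outside the set.
  refine Finset.card_bij (fun g _ => fun v => (g v : ℕ) + 1) ?_ ?_ ?_
  · intro g hg
    obtain ⟨hs, hg⟩ := (Finset.mem_filter.1 hg).2
    rw [mem_levelings]
    refine ⟨fun v => (g v).2, by simp, ?_, ?_⟩
    · intro i hi hip
      obtain ⟨v, hv⟩ := hs ⟨i - 1, by omega⟩
      exact ⟨v, by rw [hv]; simp; omega⟩
    · intro u _ v _
      simpa using hg u v
  · intro g _ g' _ h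
    funext v
    have : (g v : ℕ) + 1 = g' v + 1 := congrFun h v
    exact Fin.ext (by omega)
  · intro f hf
    obtain ⟨h1, h2, h3, h4⟩ := mem_levelings.1 hf
    have h0 : ∀ v, f v ≠ 0 := fun v h => (h2 v).1 h (Finset.mem_univ v)
    refine ⟨fun v => ⟨f v - 1, by have := h1 v; have := h0 v; omega⟩, ?_, ?_⟩
    · simp only [Finset.mem_filter, Finset.mem_univ, true_and]
      constructor
      · intro i
        obtain ⟨v, hv⟩ := h3 (i + 1) (by omega) (by omega)
        exact ⟨v, Fin.ext (by simp [hv])⟩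
      · intro u v
        have := h4 u (Finset.mem_univ u) v (Finset.mem_univ v)
        have := h0 u
        have := h0 v
        simp only [Fin.mk_le_mk, Fin.mk_lt_mk]
        exact ⟨fun h => by have := (h4 u (Finset.mem_univ u) v (Finset.mem_univ v)).1 h; omega,
          fun h => by have := (h4 u (Finset.mem_univ u) v (Finset.mem_univ v)).2 h; omega⟩
    · funext v
      have := h0 v
      simp only
      omega

end Levelings

/-! ### Reciprocity for strictly and weakly increasing surjections. -/

section Reciprocity

variable {V A : Type*}

/-- There is a directed walk from `u` to `v`. -/
abbrev Reach (D : MultiDigraph V A) : V → V → Prop :=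
  Relation.ReflTransGen (D.JoinedBy Set.univ)

theorem Reach.arc (D : MultiDigraph V A) (a : A) : D.Reach (D.src a) (D.tgt a) :=
  .single (D.joinedBy_univ a)

theorem Reach.monotone {D : MultiDigraph V A} {β : Type*} [Preorder β] {g : V → β}
    (hg : ∀ a, g (D.src a) ≤ g (D.tgt a)) {u v : V} (h : D.Reach u v) : g u ≤ g v := by
  induction h with
  | refl => exact le_rfl
  | tail _ hbc ih =>
    obtain ⟨a, -, rfl, rfl⟩ := hbc
    exact ih.trans (hg a)

/-- `U` is closed under predecessors, and every arc that ends in `U` is cyclic. -/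
def IsInitialCyclic (D : MultiDigraph V A) (U : Finset V) : Prop :=
  ∀ a, D.tgt a ∈ U → D.src a ∈ U ∧ D.Reach (D.tgt a) (D.src a)

theorem Reach.mem_of_mem {D : MultiDigraph V A} {W : Finset V}
    (hW : ∀ a, D.tgt a ∈ W → D.src a ∈ W) {u v : V} (h : D.Reach u v) (hv : v ∈ W) : u ∈ W := by
  induction h using Relation.ReflTransGen.head_induction_on with
  | refl => exact hv
  | head hab _ ih =>
    obtain ⟨a, -, rfl, rfl⟩ := hab
    exact hW a ih

/-- Two vertices are equivalent if they lie in the same strongly connected component. -/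
def strongSetoid (D : MultiDigraph V A) : Setoid V where
  r u v := D.Reach u v ∧ D.Reach v u
  iseqv := ⟨fun _ => ⟨.refl, .refl⟩, fun h => ⟨h.2, h.1⟩,
    fun h₁ h₂ => ⟨h₁.1.trans h₂.1, h₂.2.trans h₁.2⟩⟩

theorem exists_reach_minimal [Finite V] (D : MultiDigraph V A) {W : Finset V}
    (hW : W.Nonempty) : ∃ m ∈ W, ∀ v ∈ W, D.Reach v m → D.Reach m v := by
  let r : V → V → Prop := fun u v => D.Reach u v ∧ ¬ D.Reach v u
  have : Std.Irrefl r := ⟨fun _ h => h.2 h.1⟩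
  have : IsTrans V r :=
    ⟨fun _ _ _ h₁ h₂ => ⟨h₁.1.trans h₂.1, fun h => h₂.2 (h.trans h₁.1)⟩⟩
  obtain ⟨m, hm, hmin⟩ := (Finite.wellFounded_of_trans_of_irrefl r).has_min (W : Set V) hW
  refine ⟨m, hm, fun v hv h => ?_⟩
  by_contra h'
  exact hmin v hv ⟨h, h'⟩

/-- When every arc can be traversed back along a walk, undirected connection already implies strong
connection. -/
theorem natCard_strongSetoid {D : MultiDigraph V A} (hD : D.IsTotallyCyclic) :
    Nat.card (Quotient D.strongSetoid) = D.componentCount := by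
  refine Nat.card_congr ⟨Quotient.lift (fun v => Quot.mk _ v) ?_,
    Quot.lift (fun v => Quotient.mk D.strongSetoid v) ?_, ?_, ?_⟩
  · rintro u v ⟨h, -⟩
    induction h with
    | refl => rfl
    | tail _ hbc ih => exact ih.trans (Quot.sound hbc)
  · rintro u v ⟨a, -, rfl, rfl⟩
    exact Quotient.sound ⟨Reach.arc D a, (D.isCyclicArc_iff a).1 (hD a)⟩
  · rintro ⟨v⟩
    rfl
  · rintro ⟨v⟩
    rfl

variable [Fintype V] [DecidableEq V]

/-- Here `W \ U` must consist of sinks of `W`. A fixed sink can be moved in or out of `U` freely, so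
the signs cancel. -/
theorem sum_neg_one_pow_card_topStep {D : MultiDigraph V A} (hD : D.IsAcyclic) (W : Finset V)
    [DecidablePred fun U => IsTopStep (fun _ _ => False) (D.JoinedBy Set.univ) U W] :
    ∑ U ∈ W.powerset with IsTopStep (fun _ _ => False) (D.JoinedBy Set.univ) U W,
      (-1 : ℤ) ^ U.card = if W = ∅ then 1 else 0 := by
  split_ifs with hW
  · subst hW
    rw [Finset.powerset_empty, Finset.filter_singleton, if_pos (by simp [IsTopStep])]
    simp
  · obtain ⟨m, hm, hsink⟩ := hD.exists_sink (Finset.nonempty_of_ne_empty hW)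
    refine Finset.sum_involution (fun U _ => if m ∈ U then U.erase m else insert m U)
      ?_ ?_ ?_ ?_
    · intro U _
      split_ifs with h
      · rw [← Finset.card_erase_add_one h]
        ring
      · rw [Finset.card_insert_of_notMem h]
        ring
    · intro U _ _
      split_ifs with h
      · intro e
        rw [← e] at h
        exact Finset.notMem_erase m U h
      · exact fun e => h (e ▸ Finset.mem_insert_self m U)
    · intro U hU
      simp only [Finset.mem_filter, Finset.mem_powerset] at hU ⊢
      obtain ⟨hUW, hU⟩ := hU
      split_ifs with h
      · refine ⟨(Finset.erase_subset _ _).trans hUW, fun u hu v hv => ⟨False.elim, fun huv => ?_⟩⟩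
        refine Finset.mem_erase.2 ⟨?_, (hU u hu v hv).2 huv⟩
        rintro rfl
        obtain ⟨a, -, ha, rfl⟩ := huv
        exact hsink a ha hv
      · exact ⟨Finset.insert_subset hm hUW, fun u hu v hv => ⟨False.elim, fun huv =>
          Finset.mem_insert_of_mem ((hU u hu v hv).2 huv)⟩⟩
    · intro U _
      by_cases h : m ∈ U <;> simp [h]

open Classical in
/-- Reciprocity for strictly increasing surjections. -/
theorem sum_strict_surjections (D : MultiDigraph V A) (n : ℕ) (hn : Fintype.card V < n) :
    ∑ p ∈ Finset.range n, (-1 : ℤ) ^ p *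
      Set.ncard {g : V → Fin p | Function.Surjective g ∧ ∀ a, g (D.src a) < g (D.tgt a)} =
      if D.IsAcyclic then (-1) ^ Fintype.card V else 0 := by
  split_ifs with hD
  · have h := sum_neg_one_pow_card_levelings (fun _ _ => False) (D.JoinedBy Set.univ)
      (fun U => (-1 : ℤ) ^ U.card) (fun _ => True) (fun _ _ _ _ _ => trivial)
      (fun W _ => sum_neg_one_pow_card_topStep hD W) Finset.univ trivial n hn
    rw [Finset.card_univ] at h
    rw [← h]
    refine Finset.sum_congr rfl fun p _ => ?_
    rw [card_levelings_univ]
    congr 3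
    ext g
    simp only [Set.mem_ofPred_eq, and_congr_right_iff]
    intro _
    constructor
    · rintro hg u v
      refine ⟨False.elim, ?_⟩
      rintro ⟨a, -, rfl, rfl⟩
      exact hg a
    · exact fun hg a => (hg _ _).2 (D.joinedBy_univ a)
  · rw [isAcyclic_iff] at hD
    push Not at hD
    obtain ⟨a, ha⟩ := hD
    -- A strict increase along a cyclic arc contradicts monotonicity along the walk back, so no such
    -- surjection exists.
    refine Finset.sum_eq_zero fun p _ => ?_
    rw [Set.eq_empty_of_forall_notMem (s := {g : V → Fin p | _})]
    · simp
    · rintro g ⟨-, hg⟩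
      exact (hg a).not_ge (Reach.monotone (fun b => (hg b).le) ((D.isCyclicArc_iff a).1 ha))

-- The weak-case solution is the sign of the number of strong components in `U`, supported on
-- initial cyclic `U`. Toggling a source strong component `M` of `W` preserves this support and
-- changes the number by one.
open Classical in
theorem sum_initialCyclic (D : MultiDigraph V A) (W : Finset V)
    (hW : ∀ a, D.tgt a ∈ W → D.src a ∈ W) :
    ∑ U ∈ W.powerset with D.IsInitialCyclic U,
      (-1 : ℤ) ^ (U.image (Quotient.mk D.strongSetoid)).card = if W = ∅ then 1 else 0 := by
  split_ifs with hW0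
  · subst hW0
    rw [Finset.powerset_empty, Finset.filter_singleton, if_pos (by simp [IsInitialCyclic])]
    simp
  · obtain ⟨m, hm, hmin⟩ := D.exists_reach_minimal (Finset.nonempty_of_ne_empty hW0)
    -- The strong component of `m`; a predecessor-closed `U` contains it or is disjoint from it.
    set M : Finset V := {v | D.Reach v m ∧ D.Reach m v} with hM
    have memM : ∀ v, v ∈ M ↔ D.Reach v m ∧ D.Reach m v := by simp [hM]
    have hmM : m ∈ M := (memM m).2 ⟨.refl, .refl⟩
    have hMW : M ⊆ W := fun v hv => Reach.mem_of_mem hW ((memM v).1 hv).1 hm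
    have hMU : ∀ U, D.IsInitialCyclic U → m ∈ U → M ⊆ U := fun U hU hmU v hv =>
      Reach.mem_of_mem (fun a ha => (hU a ha).1) ((memM v).1 hv).1 hmU
    have hdisj : ∀ U, D.IsInitialCyclic U → m ∉ U → Disjoint U M := fun U hU hmU =>
      Finset.disjoint_left.2 fun v hv hvM => hmU
        (Reach.mem_of_mem (fun a ha => (hU a ha).1) ((memM v).1 hvM).2 hv)
    have hcard : ∀ U, Disjoint U M → ((U ∪ M).image (Quotient.mk D.strongSetoid)).card =
        (U.image (Quotient.mk D.strongSetoid)).card + 1 := by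
      intro U hU
      have himM : M.image (Quotient.mk D.strongSetoid) = {Quotient.mk D.strongSetoid m} := by
        refine Finset.eq_singleton_iff_unique_mem.2
          ⟨Finset.mem_image_of_mem _ hmM, fun x hx => ?_⟩
        obtain ⟨v, hv, rfl⟩ := Finset.mem_image.1 hx
        exact Quotient.sound ((memM v).1 hv)
      rw [Finset.image_union, himM, Finset.card_union_of_disjoint, Finset.card_singleton]
      rw [Finset.disjoint_singleton_right, Finset.mem_image]
      rintro ⟨v, hv, h⟩
      exact Finset.disjoint_left.1 hU hv ((memM v).2 (Quotient.exact h))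
    refine Finset.sum_involution (fun U _ => if m ∈ U then U \ M else U ∪ M) ?_ ?_ ?_ ?_
    · intro U hU
      have hU := (Finset.mem_filter.1 hU).2
      split_ifs with h
      · have := hcard (U \ M) Finset.sdiff_disjoint
        rw [Finset.sdiff_union_of_subset (hMU U hU h)] at this
        rw [this]
        ring
      · rw [hcard U (hdisj U hU h)]
        ring
    · intro U _ _
      split_ifs with h
      · intro e
        rw [← e] at h
        exact (Finset.mem_sdiff.1 h).2 hmM
      · exact fun e => h (e ▸ Finset.mem_union_right U hmM)
    · intro U hU
      simp only [Finset.mem_filter, Finset.mem_powerset] at hU ⊢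
      obtain ⟨hUW, hU⟩ := hU
      split_ifs with h
      -- An arc from `M` to `U \ M` would be cyclic, which would put its target in `M`.
      · refine ⟨Finset.sdiff_subset.trans hUW, fun a ha => ?_⟩
        obtain ⟨ha, haM⟩ := Finset.mem_sdiff.1 ha
        obtain ⟨h₁, h₂⟩ := hU a ha
        refine ⟨Finset.mem_sdiff.2 ⟨h₁, fun hs => haM ?_⟩, h₂⟩
        have hs := (memM _).1 hs
        exact (memM _).2 ⟨h₂.trans hs.1, hs.2.trans (Reach.arc D a)⟩
      -- By minimality of `m`, an arc ending in `M` also starts in `M`, hence is cyclic.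
      · refine ⟨Finset.union_subset hUW hMW, fun a ha => ?_⟩
        rcases Finset.mem_union.1 ha with ha | ha
        · exact ⟨Finset.mem_union_left _ (hU a ha).1, (hU a ha).2⟩
        · have ht := (memM _).1 ha
          have hs : D.Reach (D.src a) m := (Reach.arc D a).trans ht.1
          have hs' := hmin _ (hW a (hMW ha)) hs
          exact ⟨Finset.mem_union_right _ ((memM _).2 ⟨hs, hs'⟩), ht.1.trans hs'⟩
    · intro U hU
      have hU := (Finset.mem_filter.1 hU).2
      by_cases h : m ∈ U
      · simp [h, hmM, Finset.union_eq_left.2 (hMU U hU h)]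
      · simp [h, hmM, Finset.union_sdiff_cancel_right (hdisj U hU h)]

open Classical in
/-- Reciprocity for weakly increasing surjections. -/
theorem sum_weak_surjections (D : MultiDigraph V A) (n : ℕ) (hn : Fintype.card V < n) :
    ∑ p ∈ Finset.range n, (-1 : ℤ) ^ p *
      Set.ncard {g : V → Fin p | Function.Surjective g ∧ ∀ a, g (D.src a) ≤ g (D.tgt a)} =
      if D.IsTotallyCyclic then (-1) ^ D.componentCount else 0 := by
  have hsub : ∀ W : Finset V, (∀ a, D.tgt a ∈ W → D.src a ∈ W) → ∀ U ⊆ W,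
      (IsTopStep (D.JoinedBy Set.univ) (fun _ _ => False) U W ↔
        ∀ a, D.tgt a ∈ U → D.src a ∈ U) := by
    intro W hW U hU
    constructor
    · exact fun h a ha => (h _ (hW a (hU ha)) _ (hU ha)).1 (D.joinedBy_univ a) ha
    · rintro h u _ v _
      refine ⟨?_, False.elim⟩
      rintro ⟨a, -, rfl, rfl⟩
      exact h a
  -- The recursion is run only on predecessor-closed `W`, where top steps are exactly the
  -- predecessor-closed subsets.
  have h := sum_neg_one_pow_card_levelings (D.JoinedBy Set.univ) (fun _ _ => False)
    (fun U => if D.IsInitialCyclic U then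
      (-1 : ℤ) ^ (U.image (Quotient.mk D.strongSetoid)).card else 0)
    (fun W => ∀ a, D.tgt a ∈ W → D.src a ∈ W)
    (fun W hW U hU hstep => (hsub W hW U hU).1 hstep)
    (fun W hW => by
      rw [← D.sum_initialCyclic W hW, ← Finset.sum_filter, Finset.filter_filter]
      refine Finset.sum_congr (Finset.filter_congr fun U hU => ?_) fun _ _ => rfl
      rw [hsub W hW U (Finset.mem_powerset.1 hU)]
      exact ⟨fun h => h.2, fun h => ⟨fun a ha => (h a ha).1, h⟩⟩)
    Finset.univ (by simp) n hn
  have htc : D.IsInitialCyclic Finset.univ ↔ D.IsTotallyCyclic := by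
    simp [IsInitialCyclic, IsTotallyCyclic, isCyclicArc_iff]
  have hrhs : (if D.IsInitialCyclic Finset.univ then
      (-1 : ℤ) ^ (Finset.univ.image (Quotient.mk D.strongSetoid)).card else 0) =
      if D.IsTotallyCyclic then (-1) ^ D.componentCount else 0 := by
    by_cases hD : D.IsTotallyCyclic
    · rw [if_pos hD, if_pos (htc.2 hD), ← natCard_strongSetoid hD, Nat.card_eq_fintype_card,
        Finset.image_univ_of_surjective Quotient.mk_surjective, Finset.card_univ]
    · rw [if_neg hD, if_neg (mt htc.1 hD)]
  rw [← hrhs, ← h]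
  refine Finset.sum_congr rfl fun p _ => ?_
  rw [card_levelings_univ]
  congr 3
  ext g
  simp only [Set.mem_ofPred_eq, and_congr_right_iff]
  intro _
  constructor
  · rintro hg u v
    refine ⟨?_, False.elim⟩
    rintro ⟨a, -, rfl, rfl⟩
    exact hg a
  · exact fun hg a => (hg _ _).1 (D.joinedBy_univ a)

end Reciprocity

/-! ### Expanding products of arc weights into indicators. -/

section Expansion

variable {A K : Type*} [CommRing K]

theorem prod_indicator (s : Finset A) (α : A → Prop) [DecidablePred α]
    [Decidable (∀ a ∈ s, α a)] (x : K) :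
    ∏ a ∈ s, (if α a then x else 0) = x ^ s.card * if ∀ a ∈ s, α a then 1 else 0 := by
  split_ifs with h
  · rw [Finset.prod_congr rfl fun a ha => if_pos (h a ha), Finset.prod_const, mul_one]
  · push Not at h
    obtain ⟨a, ha, h⟩ := h
    rw [Finset.prod_eq_zero ha (if_neg h), mul_zero]

variable [Fintype A] [DecidableEq A]

theorem sum_finset_indicator (α β : A → Prop) [DecidablePred α] [DecidablePred β]
    {_ : ∀ S : Finset A, Decidable ((∀ a ∈ S, α a) ∧ (∀ a, a ∉ S → β a))} (x y : K) :
    ∑ S : Finset A, x ^ S.card * y ^ (Sᶜ).card *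
        (if (∀ a ∈ S, α a) ∧ (∀ a, a ∉ S → β a) then 1 else 0) =
      ∏ a, ((if α a then x else 0) + if β a then y else 0) := by
  classical
  rw [Finset.prod_add, Finset.powerset_univ]
  refine Finset.sum_congr rfl fun S _ => ?_
  rw [prod_indicator, prod_indicator, ← Finset.compl_eq_univ_sdiff]
  simp only [Finset.mem_compl]
  split_ifs <;> first | ring1 | (exfalso; tauto)

/-- Two nested binomial expansions: choose `R` first, then `S` in its complement, and `T` is what
remains. -/
theorem sum_triPartitions_indicator (α β γ : A → Prop) [DecidablePred α] [DecidablePred β]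
    [DecidablePred γ] {_ : ∀ t : Finset A × Finset A × Finset A, Decidable
      ((∀ a ∈ t.1, α a) ∧ (∀ a ∈ t.2.1, β a) ∧ (∀ a ∈ t.2.2, γ a))} (y z : K) :
    ∑ t ∈ triPartitions A, y ^ t.2.1.card * z ^ t.2.2.card *
        (if (∀ a ∈ t.1, α a) ∧ (∀ a ∈ t.2.1, β a) ∧ (∀ a ∈ t.2.2, γ a) then 1 else 0) =
      ∏ a, ((if α a then 1 else 0) + ((if β a then y else 0) + if γ a then z else 0)) := by
  classical
  rw [Finset.prod_add]
  simp_rw [Finset.prod_add, Finset.mul_sum]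
  rw [Finset.sum_sigma']
  refine Finset.sum_bij' (fun t _ => (⟨t.1, t.2.1⟩ : (_ : Finset A) × Finset A))
    (fun x _ => (x.1, x.2, (Finset.univ \ x.1) \ x.2)) ?_ ?_ ?_ ?_ ?_
  · rintro ⟨R, S, T⟩ h
    simp only [triPartitions, Finset.mem_filter, Finset.mem_univ, true_and] at h
    simp only [Finset.mem_sigma, Finset.mem_powerset, Finset.subset_univ, true_and]
    exact Finset.subset_sdiff.2 ⟨Finset.subset_univ _, h.1.symm⟩
  · rintro ⟨R, S⟩ h
    simp only [Finset.mem_sigma, Finset.mem_powerset, Finset.subset_univ, true_and,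
      Finset.subset_sdiff] at h
    simp only [triPartitions, Finset.mem_filter, Finset.mem_univ, true_and]
    refine ⟨h.symm, ?_, Finset.disjoint_sdiff, ?_⟩
    · exact Finset.disjoint_of_subset_right Finset.sdiff_subset Finset.disjoint_sdiff
    · ext a
      simp
      tauto
  · rintro ⟨R, S, T⟩ h
    simp only [triPartitions, Finset.mem_filter, Finset.mem_univ, true_and] at h
    obtain ⟨h1, h2, h3, h4⟩ := h
    simp only [Prod.mk.injEq, true_and]
    rw [sdiff_sdiff, Finset.sup_eq_union, ← h4]
    exact Finset.union_sdiff_cancel_left (Finset.disjoint_union_left.2 ⟨h2, h3⟩)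
  · rintro ⟨R, S⟩ h
    rfl
  · rintro ⟨R, S, T⟩ h
    simp only [triPartitions, Finset.mem_filter, Finset.mem_univ, true_and] at h
    obtain ⟨h1, h2, h3, h4⟩ := h
    have hT : (Finset.univ \ R) \ S = T := by
      rw [sdiff_sdiff, Finset.sup_eq_union, ← h4]
      exact Finset.union_sdiff_cancel_left (Finset.disjoint_union_left.2 ⟨h2, h3⟩)
    simp only [hT, prod_indicator, one_pow]
    split_ifs <;> first | ring1 | (exfalso; tauto)

end Expansion

/-! ### Monotone colorings of minors and reorientations. -/

section Contraction

variable {V A : Type*}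

/-- Contraction does not change the connected components. -/
theorem componentCount_contract (D : MultiDigraph V A) (R : Finset A) :
    (D.contract R).componentCount = D.componentCount := by
  classical
  refine Nat.card_congr ⟨Quot.lift (Quot.lift (fun v => Quot.mk _ v) ?_) ?_,
    Quot.lift (fun v => Quot.mk _ (Quot.mk _ v)) ?_, ?_, ?_⟩
  · rintro u v ⟨a, -, h⟩
    exact Quot.sound ⟨a, Set.mem_univ a, h⟩
  · rintro u v ⟨a, -, rfl, rfl⟩
    exact Quot.sound (D.joinedBy_univ a)
  · rintro u v ⟨a, -, rfl, rfl⟩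
    by_cases ha : a ∈ R
    · exact congrArg (Quot.mk _) (Quot.sound ⟨a, ha, rfl, rfl⟩)
    · exact Quot.sound ((D.contract R).joinedBy_univ ⟨a, ha⟩)
  · rintro ⟨⟨v⟩⟩
    rfl
  · rintro ⟨v⟩
    rfl

/-- Reorientation does not change the connected components. -/
theorem componentCount_reorient [DecidableEq A] (D : MultiDigraph V A) (T : Finset A) :
    (D.reorient T).componentCount = D.componentCount := by
  refine Nat.card_congr ⟨Quot.lift (fun v => Quot.mk _ v) ?_,
    Quot.lift (fun v => Quot.mk _ v) ?_, ?_, ?_⟩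
  · rintro u v ⟨a, -, rfl, rfl⟩
    by_cases ha : a ∈ T
    · simpa [reorient, ha] using (Quot.sound (D.joinedBy_univ a)).symm
    · simpa [reorient, ha] using Quot.sound (D.joinedBy_univ a)
  · rintro u v ⟨a, -, rfl, rfl⟩
    have h := Quot.sound ((D.reorient T).joinedBy_univ a)
    by_cases ha : a ∈ T
    · simpa [reorient, ha] using h.symm
    · simpa [reorient, ha] using h
  · rintro ⟨v⟩
    rfl
  · rintro ⟨v⟩
    rfl

/-- Colorings of a contraction are colorings that are constant along the contracted arcs. -/
theorem ncard_surjections_contract (D : MultiDigraph V A) (R : Finset A) {p : ℕ}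
    (ρ : Fin p → Fin p → Prop) :
    Set.ncard {g : V → Fin p | Function.Surjective g ∧
      (∀ a ∈ R, g (D.src a) = g (D.tgt a)) ∧ ∀ a, a ∉ R → ρ (g (D.src a)) (g (D.tgt a))} =
    Set.ncard {g : Quot (D.JoinedBy (R : Set A)) → Fin p | Function.Surjective g ∧
      ∀ a, ρ (g ((D.contract R).src a)) (g ((D.contract R).tgt a))} := by
  symm
  refine Set.ncard_congr (fun g _ => fun v => g (Quot.mk _ v)) ?_ ?_ ?_
  · intro g hg
    exact ⟨hg.1.comp Quot.mk_surjective,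
      fun a ha => congrArg g (Quot.sound ⟨a, ha, rfl, rfl⟩), fun a ha => hg.2 ⟨a, ha⟩⟩
  · intro g g' _ _ h
    funext x
    obtain ⟨v, rfl⟩ := Quot.mk_surjective x
    exact congrFun h v
  · rintro f ⟨h1, h2, h3⟩
    refine ⟨Quot.lift f ?_, ⟨fun i => ?_, fun a => h3 a a.2⟩, rfl⟩
    · rintro u v ⟨a, ha, rfl, rfl⟩
      exact h2 a ha
    · obtain ⟨v, hv⟩ := h1 i
      exact ⟨Quot.mk _ v, hv⟩

theorem forall_delete_iff (D : MultiDigraph V A) (R : Finset A) {β : Type*}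
    (ρ : β → β → Prop) (g : V → β) :
    (∀ a, ρ (g ((D.delete R).src a)) (g ((D.delete R).tgt a))) ↔
      ∀ a, a ∉ R → ρ (g (D.src a)) (g (D.tgt a)) :=
  Subtype.forall

theorem forall_mem_of_triPartition [Fintype A] [DecidableEq A] (D : MultiDigraph V A)
    {t : Finset A × Finset A × Finset A} (ht : t ∈ triPartitions A) {β : Type*}
    (ρ : β → β → Prop) (g : V → β) :
    (∀ a, a ∉ t.1 → ρ (g ((D.reorient t.2.2).src a)) (g ((D.reorient t.2.2).tgt a))) ↔
      (∀ a ∈ t.2.1, ρ (g (D.src a)) (g (D.tgt a))) ∧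
        ∀ a ∈ t.2.2, ρ (g (D.tgt a)) (g (D.src a)) := by
  obtain ⟨R, S, T⟩ := t
  simp only [triPartitions, Finset.mem_filter, Finset.mem_univ, true_and] at ht
  obtain ⟨h1, h2, h3, h4⟩ := ht
  constructor
  · intro h
    constructor
    · intro a ha
      simpa [reorient, Finset.disjoint_left.1 h3 ha] using h a (Finset.disjoint_right.1 h1 ha)
    · intro a ha
      simpa [reorient, ha] using h a (Finset.disjoint_right.1 h2 ha)
  · rintro ⟨hS, hT⟩ a ha
    by_cases haT : a ∈ T
    · simpa [reorient, haT] using hT a haT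
    · have : a ∈ R ∪ S ∪ T := h4 ▸ Finset.mem_univ a
      have haS : a ∈ S := by simpa [ha, haT] using this
      simpa [reorient, haT] using hS a haS

theorem forall_reorient_iff [DecidableEq A] (D : MultiDigraph V A) (S : Finset A) {β : Type*}
    (ρ : β → β → Prop) (g : V → β) :
    (∀ a, ρ (g ((D.reorient S).src a)) (g ((D.reorient S).tgt a))) ↔
      (∀ a ∈ S, ρ (g (D.tgt a)) (g (D.src a))) ∧ ∀ a, a ∉ S → ρ (g (D.src a)) (g (D.tgt a)) := by
  constructor
  · exact fun h => ⟨fun a ha => by simpa [reorient, ha] using h a,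
      fun a ha => by simpa [reorient, ha] using h a⟩
  · rintro ⟨h1, h2⟩ a
    by_cases ha : a ∈ S
    · simpa [reorient, ha] using h1 a ha
    · simpa [reorient, ha] using h2 a ha

theorem forall_eq_reorient_iff [DecidableEq A] (D : MultiDigraph V A) (R T : Finset A)
    {β : Type*} (g : V → β) :
    (∀ a ∈ R, g ((D.reorient T).src a) = g ((D.reorient T).tgt a)) ↔
      ∀ a ∈ R, g (D.src a) = g (D.tgt a) := by
  refine forall₂_congr fun a _ => ?_
  by_cases ha : a ∈ T <;> simp [reorient, ha, eq_comm]

end Contraction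

/-! ### The `B`-polynomial at `q = -1` as an alternating sum. -/

section AlternatingSum

variable {V A : Type*} [Fintype A]

theorem prod_ascents_descents {K : Type*} [CommRing K] (D : MultiDigraph V A) {p : ℕ}
    (g : V → Fin p) (y z : K) :
    y ^ (D.ascents g).card * z ^ (D.descents g).card =
      ∏ a, if g (D.src a) < g (D.tgt a) then y else if g (D.tgt a) < g (D.src a) then z else 1 := by
  rw [ascents, descents, ← Finset.prod_const, ← Finset.prod_const, Finset.prod_filter,
    Finset.prod_filter, ← Finset.prod_mul_distrib]
  refine Finset.prod_congr rfl fun a _ => ?_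
  rcases lt_trichotomy (g (D.src a)) (g (D.tgt a)) with h | h | h
  · simp [h, h.not_gt]
  · simp [h]
  · simp [h, h.not_gt]

variable [Fintype V] [DecidableEq V]

open Classical in
/-- The alternating sum over surjective colorings `V ↠ [p]` in which each ascent has weight `y`,
each descent weight `z` and each remaining arc weight `x`. -/
noncomputable def altSum {K : Type*} [CommRing K] (D : MultiDigraph V A) (x y z : K) : K :=
  ∑ p ∈ Finset.range (Fintype.card V + 1), (-1) ^ p *
    ∑ g : V → Fin p with Function.Surjective g,
      ∏ a, if g (D.src a) < g (D.tgt a) then y else if g (D.tgt a) < g (D.src a) then z else x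

theorem bEval_neg_one {K : Type*} [CommRing K] [Algebra ℚ K] (D : MultiDigraph V A) (y z : K) :
    D.bEval (-1) y z = D.altSum 1 y z := by
  classical
  rw [bEval, bPoly, map_sum, altSum]
  refine Finset.sum_congr rfl fun p _ => ?_
  -- This is `(-1 choose p) = (-1) ^ p`.
  have hp : algebraMap ℚ K (1 / (p.factorial : ℚ)) * ∏ i ∈ Finset.range p, (-1 - (i : K)) =
      (-1) ^ p := by
    have h1 : ∏ i ∈ Finset.range p, (-1 - (i : K)) = (-1) ^ p * algebraMap ℚ K p.factorial := by
      rw [← Finset.prod_range_add_one_eq_factorial, map_natCast, Nat.cast_prod]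
      conv_rhs => rw [← Finset.card_range p, ← Finset.prod_const, Finset.card_range,
        ← Finset.prod_mul_distrib]
      refine Finset.prod_congr rfl fun i _ => ?_
      push_cast
      ring
    rw [h1, mul_left_comm, ← map_mul, one_div,
      inv_mul_cancel₀ (by exact_mod_cast p.factorial_ne_zero), map_one, mul_one]
  simp only [map_mul, map_prod, map_sum, map_pow, map_sub, MvPolynomial.aeval_X,
    MvPolynomial.aeval_C, Matrix.cons_val_zero, Matrix.cons_val_one, Matrix.cons_val, map_natCast]
  rw [hp]
  congr 1
  refine Finset.sum_congr (Finset.filter_congr fun _ _ => Iff.rfl) fun g _ => ?_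
  rw [prod_ascents_descents]

/-- Reversing the order of the colors exchanges ascents and descents. -/
theorem altSum_swap {K : Type*} [CommRing K] (D : MultiDigraph V A) (x y z : K) :
    D.altSum x y z = D.altSum x z y := by
  classical
  refine Finset.sum_congr rfl fun p _ => ?_
  congr 1
  refine Finset.sum_bij' (fun g _ => Fin.rev ∘ g) (fun g _ => Fin.rev ∘ g) ?_ ?_ ?_ ?_ ?_
  · intro g hg
    simp only [Finset.mem_filter, Finset.mem_univ, true_and] at hg ⊢
    exact Fin.rev_surjective.comp hg
  · intro g hg
    simp only [Finset.mem_filter, Finset.mem_univ, true_and] at hg ⊢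
    exact Fin.rev_surjective.comp hg
  · intro g _
    funext v
    simp
  · intro g _
    funext v
    simp
  · intro g _
    refine Finset.prod_congr rfl fun a _ => ?_
    simp only [Function.comp_apply, Fin.rev_lt_rev]
    rcases lt_trichotomy (g (D.src a)) (g (D.tgt a)) with h | h | h
    · simp [h, h.not_gt]
    · simp [h]
    · simp [h, h.not_gt]

/-- Every arc carries exactly one weight, so one factor `x` goes to each arc. -/
theorem pow_card_mul_bEval {K : Type*} [Field K] [CharZero K] (D : MultiDigraph V A) {x : K}
    (hx : x ≠ 0) (y z : K) :
    x ^ Fintype.card A * D.bEval (-1) (y / x) (z / x) = D.altSum x y z := by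
  classical
  rw [bEval_neg_one, altSum, altSum, Finset.mul_sum]
  refine Finset.sum_congr rfl fun p _ => ?_
  rw [mul_left_comm, Finset.mul_sum]
  congr 1
  refine Finset.sum_congr rfl fun g _ => ?_
  rw [← Finset.card_univ, ← Finset.prod_const, ← Finset.prod_mul_distrib]
  refine Finset.prod_congr rfl fun a _ => ?_
  split_ifs <;> field_simp

/-- Each arc weight has degree at most one, so the coefficient at `|A|` takes the linear coefficient
from every arc; a tie contributes `0`. -/
theorem coeff_altSum {K : Type*} [CommRing K] (D : MultiDigraph V A) (y : K) :
    (D.altSum 1 (Polynomial.C y * Polynomial.X) Polynomial.X : Polynomial K).coeff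
      (Fintype.card A) = D.altSum 0 y 1 := by
  classical
  rw [altSum, altSum, Polynomial.finsetSum_coeff]
  refine Finset.sum_congr rfl fun p _ => ?_
  rw [show ((-1 : Polynomial K) ^ p) = Polynomial.C ((-1) ^ p) by simp,
    Polynomial.coeff_C_mul, Polynomial.finsetSum_coeff]
  congr 1
  refine Finset.sum_congr rfl fun g _ => ?_
  have := Polynomial.coeff_prod_of_natDegree_le (s := (Finset.univ : Finset A))
    (fun a => if g (D.src a) < g (D.tgt a) then Polynomial.C y * Polynomial.X else
      if g (D.tgt a) < g (D.src a) then (Polynomial.X : Polynomial K) else 1) 1 (by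
      intro a _
      split_ifs
      · exact (Polynomial.natDegree_C_mul_le _ _).trans Polynomial.natDegree_X_le
      · exact Polynomial.natDegree_X_le
      · simp)
  rw [Finset.card_univ, mul_one] at this
  rw [this]
  refine Finset.prod_congr rfl fun a _ => ?_
  split_ifs <;> simp [Polynomial.coeff_one]

open Classical in
/-- An expansion of all arc weights into indicator functions gives an expansion of the
alternating sum. -/
theorem altSum_eq_sum {K ι : Type*} [CommRing K] (D : MultiDigraph V A) (x y z : K)
    (I : Finset ι) (c : ι → K) (P : ι → ∀ {p : ℕ}, (V → Fin p) → Prop) (Q : ι → Prop)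
    [DecidablePred Q] (e : ι → ℕ)
    (hexp : ∀ (p : ℕ) (g : V → Fin p), ∏ a, (if g (D.src a) < g (D.tgt a) then y else
      if g (D.tgt a) < g (D.src a) then z else x) = ∑ i ∈ I, c i * if P i g then 1 else 0)
    (hrec : ∀ i ∈ I, ∑ p ∈ Finset.range (Fintype.card V + 1), (-1 : ℤ) ^ p *
      Set.ncard {g : V → Fin p | Function.Surjective g ∧ P i g} =
        if Q i then (-1) ^ e i else 0) :
    D.altSum x y z = ∑ i ∈ I with Q i, c i * (-1) ^ e i := by
  rw [altSum, Finset.sum_filter]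
  simp_rw [hexp, Finset.sum_comm (t := I), Finset.mul_sum (s := I)]
  rw [Finset.sum_comm]
  refine Finset.sum_congr rfl fun i hi => ?_
  have h := congrArg (Int.cast : ℤ → K) (hrec i hi)
  push_cast at h
  rw [← mul_ite_zero, ← h, Finset.mul_sum]
  refine Finset.sum_congr rfl fun p _ => ?_
  rw [← Finset.mul_sum, Set.ncard_eq_toFinset_card', Set.toFinset_ofPred,
    ← Finset.filter_filter, Finset.sum_boole]
  ring

end AlternatingSum

/-! ### Reciprocity transferred to contractions. -/

section ContractionReciprocity

variable {V A : Type*} [Fintype V]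

theorem sum_strict_surjections_contract (D : MultiDigraph V A) (R : Finset A) :
    ∑ p ∈ Finset.range (Fintype.card V + 1), (-1 : ℤ) ^ p *
      Set.ncard {g : V → Fin p | Function.Surjective g ∧
        (∀ a ∈ R, g (D.src a) = g (D.tgt a)) ∧ ∀ a, a ∉ R → g (D.src a) < g (D.tgt a)} =
      if (D.contract R).IsAcyclic then (-1) ^ (D.contract R).vertexCount else 0 := by
  classical
  let _ : Fintype (Quot (D.JoinedBy (R : Set A))) := Fintype.ofFinite _
  -- The range for `V` still suffices, as the contraction has at most as many vertices.
  rw [vertexCount, Nat.card_eq_fintype_card, ← (D.contract R).sum_strict_surjections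
    (Fintype.card V + 1) (Nat.lt_succ_of_le (Fintype.card_le_of_surjective _ Quot.mk_surjective))]
  refine Finset.sum_congr rfl fun p _ => ?_
  rw [D.ncard_surjections_contract R (fun i j => i < j)]

theorem sum_weak_surjections_contract (D : MultiDigraph V A) (R : Finset A) :
    ∑ p ∈ Finset.range (Fintype.card V + 1), (-1 : ℤ) ^ p *
      Set.ncard {g : V → Fin p | Function.Surjective g ∧
        (∀ a ∈ R, g (D.src a) = g (D.tgt a)) ∧ ∀ a, a ∉ R → g (D.src a) ≤ g (D.tgt a)} =
      if (D.contract R).IsTotallyCyclic then (-1) ^ D.componentCount else 0 := by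
  classical
  let _ : Fintype (Quot (D.JoinedBy (R : Set A))) := Fintype.ofFinite _
  rw [← D.componentCount_contract R, ← (D.contract R).sum_weak_surjections
    (Fintype.card V + 1) (Nat.lt_succ_of_le (Fintype.card_le_of_surjective _ Quot.mk_surjective))]
  refine Finset.sum_congr rfl fun p _ => ?_
  rw [D.ncard_surjections_contract R (fun i j => i ≤ j)]

end ContractionReciprocity

/-! ### The eight expansions, one for each choice of arc conditions. -/

section Identities

variable {V A K : Type*} [Fintype V] [DecidableEq V] [Fintype A] [DecidableEq A] [CommRing K]

theorem altSum_eq_sum_delete_acyclic (D : MultiDigraph V A) (y z : K) :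
    D.altSum 1 (1 + y) (1 + z) =
      ∑ t ∈ triPartitions A with ((D.reorient t.2.2).delete t.1).IsAcyclic,
        y ^ t.2.1.card * z ^ t.2.2.card * (-1) ^ Fintype.card V := by
  classical
  rw [D.altSum_eq_sum 1 (1 + y) (1 + z) (triPartitions A)
    (fun t => y ^ t.2.1.card * z ^ t.2.2.card)
    (fun t _ g => (∀ a ∈ t.1, True) ∧ (∀ a ∈ t.2.1, g (D.src a) < g (D.tgt a)) ∧
      ∀ a ∈ t.2.2, g (D.tgt a) < g (D.src a))
    (fun t => ((D.reorient t.2.2).delete t.1).IsAcyclic) (fun _ => Fintype.card V)]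
  · intro p g
    refine Eq.trans ?_ (sum_triPartitions_indicator (fun _ => True)
      (fun a => g (D.src a) < g (D.tgt a)) (fun a => g (D.tgt a) < g (D.src a)) y z).symm
    refine Finset.prod_congr rfl fun a _ => ?_
    rcases lt_trichotomy (g (D.src a)) (g (D.tgt a)) with h | h | h
    · simp [h, h.not_gt]
    · simp [h]
    · simp [h, h.not_gt]
  · intro t ht
    have h := ((D.reorient t.2.2).delete t.1).sum_strict_surjections _ (Nat.lt_succ_self _)
    simp only [forall_delete_iff _ _ (fun i j => i < j),
      D.forall_mem_of_triPartition ht (fun i j => i < j)] at h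
    simpa only [implies_true, true_and] using h

/-- With weak inequalities a tie satisfies all three conditions, hence its weight `1 + y + z`. -/
theorem altSum_eq_sum_delete_totallyCyclic (D : MultiDigraph V A) (y z : K) :
    D.altSum (1 + y + z) (1 + y) (1 + z) =
      ∑ t ∈ triPartitions A with ((D.reorient t.2.2).delete t.1).IsTotallyCyclic,
        y ^ t.2.1.card * z ^ t.2.2.card *
          (-1) ^ ((D.reorient t.2.2).delete t.1).componentCount := by
  classical
  rw [D.altSum_eq_sum (1 + y + z) (1 + y) (1 + z) (triPartitions A)
    (fun t => y ^ t.2.1.card * z ^ t.2.2.card)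
    (fun t _ g => (∀ a ∈ t.1, True) ∧ (∀ a ∈ t.2.1, g (D.src a) ≤ g (D.tgt a)) ∧
      ∀ a ∈ t.2.2, g (D.tgt a) ≤ g (D.src a))
    (fun t => ((D.reorient t.2.2).delete t.1).IsTotallyCyclic)
    (fun t => ((D.reorient t.2.2).delete t.1).componentCount)]
  · intro p g
    refine Eq.trans ?_ (sum_triPartitions_indicator (fun _ => True)
      (fun a => g (D.src a) ≤ g (D.tgt a)) (fun a => g (D.tgt a) ≤ g (D.src a)) y z).symm
    refine Finset.prod_congr rfl fun a _ => ?_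
    rcases lt_trichotomy (g (D.src a)) (g (D.tgt a)) with h | h | h
    · simp [h, h.le, h.not_ge]
    · simp [h, add_assoc]
    · simp [h, h.le, h.not_ge, h.not_gt]
  · intro t ht
    have h := ((D.reorient t.2.2).delete t.1).sum_weak_surjections _ (Nat.lt_succ_self _)
    simp only [forall_delete_iff _ _ (fun i j => i ≤ j),
      D.forall_mem_of_triPartition ht (fun i j => i ≤ j)] at h
    simpa only [implies_true, true_and] using h

theorem altSum_eq_sum_contract_acyclic (D : MultiDigraph V A) (y z : K) :
    D.altSum 1 y z =
      ∑ t ∈ triPartitions A with ((D.reorient t.2.2).contract t.1).IsAcyclic,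
        y ^ t.2.1.card * z ^ t.2.2.card *
          (-1) ^ ((D.reorient t.2.2).contract t.1).vertexCount := by
  classical
  rw [D.altSum_eq_sum 1 y z (triPartitions A)
    (fun t => y ^ t.2.1.card * z ^ t.2.2.card)
    (fun t _ g => (∀ a ∈ t.1, g (D.src a) = g (D.tgt a)) ∧
      (∀ a ∈ t.2.1, g (D.src a) < g (D.tgt a)) ∧ ∀ a ∈ t.2.2, g (D.tgt a) < g (D.src a))
    (fun t => ((D.reorient t.2.2).contract t.1).IsAcyclic)
    (fun t => ((D.reorient t.2.2).contract t.1).vertexCount)]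
  · intro p g
    refine Eq.trans ?_ (sum_triPartitions_indicator (fun a => g (D.src a) = g (D.tgt a))
      (fun a => g (D.src a) < g (D.tgt a)) (fun a => g (D.tgt a) < g (D.src a)) y z).symm
    refine Finset.prod_congr rfl fun a _ => ?_
    rcases lt_trichotomy (g (D.src a)) (g (D.tgt a)) with h | h | h
    · simp [h, h.ne, h.not_gt]
    · simp [h]
    · simp [h, h.ne', h.not_gt]
  · intro t ht
    have h := (D.reorient t.2.2).sum_strict_surjections_contract t.1
    simpa only [D.forall_mem_of_triPartition ht (fun i j => i < j), forall_eq_reorient_iff] using h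

theorem altSum_eq_sum_contract_totallyCyclic (D : MultiDigraph V A) (y z : K) :
    D.altSum (1 + y + z) y z =
      ∑ t ∈ triPartitions A with ((D.reorient t.2.2).contract t.1).IsTotallyCyclic,
        y ^ t.2.1.card * z ^ t.2.2.card * (-1) ^ D.componentCount := by
  classical
  rw [D.altSum_eq_sum (1 + y + z) y z (triPartitions A)
    (fun t => y ^ t.2.1.card * z ^ t.2.2.card)
    (fun t _ g => (∀ a ∈ t.1, g (D.src a) = g (D.tgt a)) ∧
      (∀ a ∈ t.2.1, g (D.src a) ≤ g (D.tgt a)) ∧ ∀ a ∈ t.2.2, g (D.tgt a) ≤ g (D.src a))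
    (fun t => ((D.reorient t.2.2).contract t.1).IsTotallyCyclic)
    (fun _ => D.componentCount)]
  · intro p g
    refine Eq.trans ?_ (sum_triPartitions_indicator (fun a => g (D.src a) = g (D.tgt a))
      (fun a => g (D.src a) ≤ g (D.tgt a)) (fun a => g (D.tgt a) ≤ g (D.src a)) y z).symm
    refine Finset.prod_congr rfl fun a _ => ?_
    rcases lt_trichotomy (g (D.src a)) (g (D.tgt a)) with h | h | h
    · simp [h, h.ne, h.le, h.not_ge]
    · simp [h, add_assoc]
    · simp [h, h.ne', h.le, h.not_ge, h.not_gt]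
  · intro t ht
    have h := (D.reorient t.2.2).sum_weak_surjections_contract t.1
    simpa only [D.forall_mem_of_triPartition ht (fun i j => i ≤ j), forall_eq_reorient_iff,
      componentCount_reorient] using h

theorem altSum_eq_sum_reorient_acyclic (D : MultiDigraph V A) (y : K) :
    D.altSum 0 1 y =
      ∑ S : Finset A with (D.reorient S).IsAcyclic, y ^ S.card * (-1) ^ Fintype.card V := by
  classical
  rw [D.altSum_eq_sum 0 1 y Finset.univ (fun S : Finset A => y ^ S.card * 1 ^ (Sᶜ).card)
    (fun S _ g => (∀ a ∈ S, g (D.tgt a) < g (D.src a)) ∧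
      ∀ a, a ∉ S → g (D.src a) < g (D.tgt a))
    (fun S => (D.reorient S).IsAcyclic) (fun _ => Fintype.card V)]
  · exact Finset.sum_congr rfl fun _ _ => by simp
  · intro p g
    refine Eq.trans ?_ (sum_finset_indicator (fun a => g (D.tgt a) < g (D.src a))
      (fun a => g (D.src a) < g (D.tgt a)) y 1).symm
    refine Finset.prod_congr rfl fun a _ => ?_
    rcases lt_trichotomy (g (D.src a)) (g (D.tgt a)) with h | h | h
    · simp [h, h.not_gt]
    · simp [h]
    · simp [h, h.not_gt]
  · intro S _
    have h := (D.reorient S).sum_strict_surjections _ (Nat.lt_succ_self _)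
    simpa only [D.forall_reorient_iff S (fun i j => i < j)] using h

theorem altSum_eq_sum_subgraph_acyclic (D : MultiDigraph V A) (y : K) :
    D.altSum 1 (1 + y) 1 =
      ∑ S : Finset A with (D.delete S).IsAcyclic, y ^ (Sᶜ).card * (-1) ^ Fintype.card V := by
  classical
  rw [D.altSum_eq_sum 1 (1 + y) 1 Finset.univ (fun S : Finset A => 1 ^ S.card * y ^ (Sᶜ).card)
    (fun S _ g => (∀ a ∈ S, True) ∧ ∀ a, a ∉ S → g (D.src a) < g (D.tgt a))
    (fun S => (D.delete S).IsAcyclic) (fun _ => Fintype.card V)]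
  · exact Finset.sum_congr rfl fun _ _ => by simp
  · intro p g
    refine Eq.trans ?_ (sum_finset_indicator (fun _ => True)
      (fun a => g (D.src a) < g (D.tgt a)) 1 y).symm
    refine Finset.prod_congr rfl fun a _ => ?_
    rcases lt_trichotomy (g (D.src a)) (g (D.tgt a)) with h | h | h
    · simp [h]
    · simp [h]
    · simp [h, h.not_gt]
  · intro S _
    have h := (D.delete S).sum_strict_surjections _ (Nat.lt_succ_self _)
    simp only [forall_delete_iff _ _ (fun i j => i < j)] at h
    simpa only [implies_true, true_and] using h

theorem altSum_eq_sum_reorient_totallyCyclic (D : MultiDigraph V A) (y : K) :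
    D.altSum (1 + y) 1 y =
      ∑ S : Finset A with (D.reorient S).IsTotallyCyclic,
        y ^ S.card * (-1) ^ D.componentCount := by
  classical
  rw [D.altSum_eq_sum (1 + y) 1 y Finset.univ (fun S : Finset A => y ^ S.card * 1 ^ (Sᶜ).card)
    (fun S _ g => (∀ a ∈ S, g (D.tgt a) ≤ g (D.src a)) ∧
      ∀ a, a ∉ S → g (D.src a) ≤ g (D.tgt a))
    (fun S => (D.reorient S).IsTotallyCyclic) (fun _ => D.componentCount)]
  · exact Finset.sum_congr rfl fun _ _ => by simp
  · intro p g
    refine Eq.trans ?_ (sum_finset_indicator (fun a => g (D.tgt a) ≤ g (D.src a))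
      (fun a => g (D.src a) ≤ g (D.tgt a)) y 1).symm
    refine Finset.prod_congr rfl fun a _ => ?_
    rcases lt_trichotomy (g (D.src a)) (g (D.tgt a)) with h | h | h
    · simp [h, h.le, h.not_ge]
    · simp [h, add_comm]
    · simp [h, h.le, h.not_ge, h.not_gt]
  · intro S _
    have h := (D.reorient S).sum_weak_surjections _ (Nat.lt_succ_self _)
    simpa only [D.forall_reorient_iff S (fun i j => i ≤ j), componentCount_reorient] using h

/-- The weight is `[=] + y[≤]`: ties count `1 + y`, and descents satisfy neither condition. -/
theorem altSum_eq_sum_contraction_totallyCyclic (D : MultiDigraph V A) (y : K) :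
    D.altSum (1 + y) y 0 =
      ∑ S : Finset A with (D.contract S).IsTotallyCyclic,
        y ^ (Sᶜ).card * (-1) ^ D.componentCount := by
  classical
  rw [D.altSum_eq_sum (1 + y) y 0 Finset.univ (fun S : Finset A => 1 ^ S.card * y ^ (Sᶜ).card)
    (fun S _ g => (∀ a ∈ S, g (D.src a) = g (D.tgt a)) ∧
      ∀ a, a ∉ S → g (D.src a) ≤ g (D.tgt a))
    (fun S => (D.contract S).IsTotallyCyclic) (fun _ => D.componentCount)]
  · exact Finset.sum_congr rfl fun _ _ => by simp
  · intro p g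
    refine Eq.trans ?_ (sum_finset_indicator (fun a => g (D.src a) = g (D.tgt a))
      (fun a => g (D.src a) ≤ g (D.tgt a)) 1 y).symm
    refine Finset.prod_congr rfl fun a _ => ?_
    rcases lt_trichotomy (g (D.src a)) (g (D.tgt a)) with h | h | h
    · simp [h, h.ne, h.le]
    · simp [h]
    · simp [h, h.ne', h.not_ge, h.not_gt]
  · intro S _
    exact D.sum_weak_surjections_contract S

theorem neg_one_pow_mul_sum {ι : Type*} (n : ℕ) (I : Finset ι) (c : ι → K) :
    (-1) ^ n * ∑ i ∈ I, c i * (-1) ^ n = ∑ i ∈ I, c i := by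
  rw [← Finset.sum_mul, mul_left_comm, ← mul_pow]
  simp

end Identities

end MultiDigraph

theorem theorem6p6 {V A K : Type*} [Fintype V] [DecidableEq V] [Fintype A] [DecidableEq A]
    [Field K] [CharZero K] (D : MultiDigraph V A) :
    -- deletion and reorientation, acyclic
    (∀ y z : K,
      ∑ p ∈ MultiDigraph.triPartitions A with ((D.reorient p.2.2).delete p.1).IsAcyclic,
          y ^ p.2.1.card * z ^ p.2.2.card =
        (-1) ^ Fintype.card V * D.bEval (-1) (1 + y) (1 + z)) ∧
    -- deletion and reorientation, totally cyclic
    (∀ y z : K, 1 + y + z ≠ 0 →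
      ∑ p ∈ MultiDigraph.triPartitions A with ((D.reorient p.2.2).delete p.1).IsTotallyCyclic,
          y ^ p.2.1.card * z ^ p.2.2.card *
            (-1) ^ ((D.reorient p.2.2).delete p.1).componentCount =
        (1 + y + z) ^ Fintype.card A *
          D.bEval (-1) ((1 + y) / (1 + y + z)) ((1 + z) / (1 + y + z))) ∧
    -- contraction and reorientation, acyclic
    (∀ y z : K,
      ∑ p ∈ MultiDigraph.triPartitions A with ((D.reorient p.2.2).contract p.1).IsAcyclic,
          y ^ p.2.1.card * z ^ p.2.2.card *
            (-1) ^ ((D.reorient p.2.2).contract p.1).vertexCount =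
        D.bEval (-1) y z) ∧
    -- contraction and reorientation, totally cyclic
    (∀ y z : K, 1 + y + z ≠ 0 →
      ∑ p ∈ MultiDigraph.triPartitions A with ((D.reorient p.2.2).contract p.1).IsTotallyCyclic,
          y ^ p.2.1.card * z ^ p.2.2.card =
        (-1) ^ D.componentCount * (1 + y + z) ^ Fintype.card A *
          D.bEval (-1) (y / (1 + y + z)) (z / (1 + y + z))) ∧
    -- acyclic reorientations: a coefficient of a polynomial in `z` over `K`
    (∀ y : K,
      ∑ S : Finset A with (D.reorient S).IsAcyclic, y ^ S.card =
        (-1) ^ Fintype.card V *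
          (D.bEval (-1) (Polynomial.C y * Polynomial.X) Polynomial.X : Polynomial K).coeff
            (Fintype.card A)) ∧
    -- acyclic subgraphs
    (∀ y : K,
      ∑ S : Finset A with (D.delete S).IsAcyclic, y ^ (Sᶜ).card =
        (-1) ^ Fintype.card V * D.bEval (-1) (1 + y) 1) ∧
    -- totally cyclic reorientations
    (∀ y : K, 1 + y ≠ 0 →
      ∑ S : Finset A with (D.reorient S).IsTotallyCyclic, y ^ S.card =
        (-1) ^ D.componentCount * (1 + y) ^ Fintype.card A *
          D.bEval (-1) (y / (1 + y)) (1 / (1 + y))) ∧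
    -- totally cyclic contractions
    (∀ y : K, 1 + y ≠ 0 →
      ∑ S : Finset A with (D.contract S).IsTotallyCyclic, y ^ (Sᶜ).card =
        (-1) ^ D.componentCount * (1 + y) ^ Fintype.card A *
          D.bEval (-1) (y / (1 + y)) 0) := by
  refine ⟨fun y z => ?_, fun y z h => ?_, fun y z => ?_, fun y z h => ?_, fun y => ?_,
    fun y => ?_, fun y h => ?_, fun y h => ?_⟩
  · rw [D.bEval_neg_one, D.altSum_eq_sum_delete_acyclic, MultiDigraph.neg_one_pow_mul_sum]
  · rw [D.pow_card_mul_bEval h, D.altSum_eq_sum_delete_totallyCyclic]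
  · rw [D.bEval_neg_one, D.altSum_eq_sum_contract_acyclic]
  · rw [mul_assoc, D.pow_card_mul_bEval h, D.altSum_eq_sum_contract_totallyCyclic,
      MultiDigraph.neg_one_pow_mul_sum]
  -- The swap moves `y` from ascents to descents, the arcs that get reversed.
  · rw [D.bEval_neg_one, D.coeff_altSum, D.altSum_swap, D.altSum_eq_sum_reorient_acyclic,
      MultiDigraph.neg_one_pow_mul_sum]
  · rw [D.bEval_neg_one, D.altSum_eq_sum_subgraph_acyclic, MultiDigraph.neg_one_pow_mul_sum]
  · rw [mul_assoc, D.pow_card_mul_bEval h, D.altSum_swap,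
      D.altSum_eq_sum_reorient_totallyCyclic, MultiDigraph.neg_one_pow_mul_sum]
  · have h0 := D.pow_card_mul_bEval h y 0
    rw [zero_div] at h0
    rw [mul_assoc, h0, D.altSum_eq_sum_contraction_totallyCyclic,
      MultiDigraph.neg_one_pow_mul_sum]
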